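/- An instance of the Steiner tree problem consists of a finite undirected graph $G=(V,E)$, edge costs $c_e\ge 0$ $(e\in E)$ and a set $R\subseteq V$ of terminals; the vertices in $V\setminus R$ are called Steiner vertices. Fix a terminal $r\in R$ as root. A set $U\subseteq V$ is valid if $U\cap R\neq\varnothing$ and $r\notin U$. The bidirected cut relaxation $(\mathcal B)$: let $A$ contain the two arcs $(u,v),(v,u)$, each of cost $c_{uv}$, for every edge $uv\in E$, and let $\delta^{\mathrm{out}}(U)$ be the set of arcs with tail in $U$ and head in $V\setminus U$. Then $$\mathrm{OPT}(\mathcal B)=\min\Big\{\sum_{a\in A}c_ax_a:\ x\in\mathbf R^A_{\ge0},\ \sum_{a\in\delta^{\mathrm{out}}(U)}x_a\ge1\ \text{ for all valid } U\subseteq V\Big\}.$$ The directed hypergraphic relaxation $(\mathcal D)$: for a nonempty set $K\subseteq R$, a full component spanning $K$ is a subtree of $G$ whose set of terminals is $K$, all of whose leaves are terminals and all of whose internal vertices are Steiner vertices (for $|K|=1$ it is the one-vertex tree). Let $C_K$ be the minimum total edge cost of a full component spanning $K$, and $C_K=\infty$ if there is none. There is a variable $x_{K^i}$ for every nonempty $K\subseteq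 R$ and every $i\in K$, and $$\mathrm{OPT}(\mathcal D)=\min\Big\{\sum_{\varnothing\ne K\subseteq R,\ i\in K}C_Kx_{K^i}:\ x\ge0,\ \sum_{(K,i):\,K\cap U\neq\varnothing,\ i\notin U}x_{K^i}\ge1\ \text{ for all valid } U\subseteq R\Big\},$$ with the convention $\infty\cdot 0=0$. A relaxation without a feasible solution of finite cost has optimal value $+\infty$. Theorem. If the instance is quasibipartite, i.e. no two Steiner vertices are adjacent, then for every root $r\in R$ $$\mathrm{OPT}(\mathcal B)\ \ge\ \mathrm{OPT}(\mathcal D),$$ and in fact $\mathrm{OPT}(\mathcal B)=\mathrm{OPT}(\mathcal D)$. -/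

import Mathlib

open scoped NNReal ENNReal

/-- An instance of the Steiner tree problem on the vertex set `V`: an undirected graph, a
non-negative cost for every edge (values of `cost` at non-edges play no role), and a set of
terminals.  Vertices that are not terminals are Steiner vertices. -/
structure SteinerInstance (V : Type*) where
  graph : SimpleGraph V
  cost : Sym2 V → ℝ≥0
  terminals : Finset V

namespace SteinerInstance

/-- The Steiner vertices form an independent set. -/
def IsQuasibipartite {V : Type*} (I : SteinerInstance V) : Prop :=
  I.graph.IsIndepSet {v | v ∉ I.terminals}

/-- `U` contains a terminal but not the root `r`. -/
def IsValid {V : Type*} (I : SteinerInstance V) (r : V) (U : Finset V) : Prop :=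
  (∃ t ∈ I.terminals, t ∈ U) ∧ r ∉ U

/-! ### The bidirected cut relaxation -/

open Classical in
/-- `δᵒᵘᵗ(U)`: the arcs with tail in `U` and head outside `U`.  The arcs are the darts of the
graph, i.e. the two orientations of every edge. -/
noncomputable def arcsOut {V : Type*} [Fintype V] (I : SteinerInstance V) (U : Finset V) :
    Finset I.graph.Dart :=
  Finset.univ.filter fun a => a.fst ∈ U ∧ a.snd ∉ U

/-- Feasible solutions of the bidirected cut relaxation. -/
def FeasibleB {V : Type*} [Fintype V] (I : SteinerInstance V) (r : V)
    (x : I.graph.Dart → ℝ≥0) : Prop :=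
  ∀ U : Finset V, I.IsValid r U → 1 ≤ ∑ a ∈ I.arcsOut U, x a

open Classical in
/-- The cost of an arc vector; each arc costs as much as its underlying edge. -/
noncomputable def valueB {V : Type*} [Fintype V] (I : SteinerInstance V)
    (x : I.graph.Dart → ℝ≥0) : ℝ≥0∞ :=
  ∑ a : I.graph.Dart, (I.cost a.edge : ℝ≥0∞) * (x a : ℝ≥0∞)

/-- The optimal value of the bidirected cut relaxation (`∞` if it is infeasible). -/
noncomputable def optB {V : Type*} [Fintype V] (I : SteinerInstance V) (r : V) : ℝ≥0∞ :=
  ⨅ (x : I.graph.Dart → ℝ≥0) (_ : I.FeasibleB r x), I.valueB x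

/-! ### The directed hypergraphic relaxation -/

/-- `T` is a full component spanning the set `K` of terminals: a subtree of the graph whose
terminals are the elements of `K`, all of whose leaves are terminals and all of whose other
vertices are Steiner vertices.  (A leaf is a vertex of degree at most one, so that the full
component of a single terminal is the one-vertex tree.) -/
def IsFullComponent {V : Type*} (I : SteinerInstance V) (K : Finset V)
    (T : I.graph.Subgraph) : Prop :=
  T.coe.IsTree ∧
  (∀ v, v ∈ K ↔ v ∈ T.verts ∧ v ∈ I.terminals) ∧
  (∀ v ∈ T.verts, v ∈ I.terminals ↔ (T.neighborSet v).ncard ≤ 1)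

open Classical in
/-- The total cost of the edges of a subgraph. -/
noncomputable def subgraphCost {V : Type*} [Fintype V] (I : SteinerInstance V)
    (T : I.graph.Subgraph) : ℝ≥0 :=
  ∑ e : Sym2 V with e ∈ T.edgeSet, I.cost e

/-- `C_K`: the minimum cost of a full component spanning `K`, and `∞` if there is none. -/
noncomputable def hyperedgeCost {V : Type*} [Fintype V] (I : SteinerInstance V)
    (K : Finset V) : ℝ≥0∞ :=
  ⨅ (T : I.graph.Subgraph) (_ : I.IsFullComponent K T), (I.subgraphCost T : ℝ≥0∞)

/-- The directed hyperedges `Kⁱ`: a (nonempty) set `K` of terminals together with a head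
`i ∈ K`. -/
abbrev DirHyperedge {V : Type*} (I : SteinerInstance V) : Type _ :=
  {p : Finset V × V // p.1 ⊆ I.terminals ∧ p.2 ∈ p.1}

open Classical in
/-- `Δᵒᵘᵗ(U)`: the directed hyperedges `Kⁱ` with `U ∩ K ≠ ∅` and `i ∉ U`. -/
noncomputable def hyperedgesOut {V : Type*} [Fintype V] (I : SteinerInstance V)
    (U : Finset V) : Finset I.DirHyperedge :=
  Finset.univ.filter fun h => (∃ t ∈ U, t ∈ h.1.1) ∧ h.1.2 ∉ U

/-- Feasible solutions of the directed hypergraphic relaxation. -/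
def FeasibleD {V : Type*} [Fintype V] (I : SteinerInstance V) (r : V)
    (x : I.DirHyperedge → ℝ≥0) : Prop :=
  ∀ U : Finset V, U ⊆ I.terminals → I.IsValid r U → 1 ≤ ∑ h ∈ I.hyperedgesOut U, x h

open Classical in
/-- The cost of a vector of directed hyperedges.  As `∞ * 0 = 0` in `ℝ≥0∞`, hyperedges without a
full component may be present as long as they have value zero. -/
noncomputable def valueD {V : Type*} [Fintype V] (I : SteinerInstance V)
    (x : I.DirHyperedge → ℝ≥0) : ℝ≥0∞ :=
  ∑ h : I.DirHyperedge, I.hyperedgeCost h.1.1 * (x h : ℝ≥0∞)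

/-- The optimal value of the directed hypergraphic relaxation (`∞` if there is no feasible
solution of finite cost). -/
noncomputable def optD {V : Type*} [Fintype V] (I : SteinerInstance V) (r : V) : ℝ≥0∞ :=
  ⨅ (x : I.DirHyperedge → ℝ≥0) (_ : I.FeasibleD r x), I.valueD x

end SteinerInstance

/-!
Both relaxations of a quasibipartite Steiner tree instance have the same value.

`optB_le_optD` holds for every instance: a full component spanning `K`, oriented towards `i ∈ K`,
sends an arc out of every vertex set that meets `K` and avoids `i`.  So replacing each hyperedge
`Kⁱ` by its oriented optimal full component turns a feasible solution of the hypergraphic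
relaxation into one of the cut relaxation of no larger cost.

For `optD_le_optB`, consider mixed vectors, which have entries on arcs and on directed hyperedges
and cover every valid set `U ⊆ V` by their joint cut.  Among those that cost at most as much as a
given solution `x` of the cut relaxation there is, by compactness, one with the least total weight
on arcs.  It has no weight on arcs with a terminal head.  Hence no arc of positive weight leaves
the union of a set `U` of terminals with all Steiner vertices, so its hyperedge part alone is
feasible.

The reason for this vanishing is that weight on such an arc can be shifted to hyperedges.  This is
clear for an arc between terminals.  For an arc from a Steiner vertex `s` to a terminal `i`, take
an inclusion-minimal set `K` of tails of positive arcs into `s` that meets every tight set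
containing `s` but not `i`, and move a small weight from the arc `(s, i)` and the arcs `(k, s)`,
`k ∈ K`, to the hyperedge `K ∪ {i}` with head `i`, whose full component is a star centred at `s`
because all neighbours of `s` are terminals.  A tight set `T` avoiding `s` might lose too much: it
does so if it contains two elements of `K`, or one element of `K` and `i`.  By minimality, each
`k ∈ K` lies in a tight set `U` that contains `s` but neither `i` nor another element of `K`.  If
`k ∈ T`, then `T ∩ U` and `T ∪ U` are valid, and submodularity of the cut
(`mixedCut_inter_add_mixedCut_union_add_le`) forces all arcs between `s` and `T \ U` to have weight
zero, which excludes both possibilities (`IsDominated.not_pos_of_tight`).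
-/

open Filter Topology

namespace SteinerInstance

variable {V : Type*} (I : SteinerInstance V)

/-! ### Full components -/

/-- The star with centre `c` and leaf set `L`, as a subgraph of the instance. -/
def starSubgraph (c : V) (L : Finset V) (hL : ∀ l ∈ L, I.graph.Adj c l) : I.graph.Subgraph where
  verts := insert c (L : Set V)
  Adj v w := (v = c ∧ w ∈ L) ∨ (w = c ∧ v ∈ L)
  adj_sub := by
    rintro v w (⟨rfl, h⟩ | ⟨rfl, h⟩)
    exacts [hL _ h, (hL _ h).symm]
  edge_vert := by
    rintro v w (⟨rfl, h⟩ | ⟨rfl, h⟩)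
    exacts [Or.inl rfl, Or.inr h]
  symm := ⟨fun v w h => Or.symm h⟩

theorem isTree_starSubgraph (c : V) (L : Finset V) (hL : ∀ l ∈ L, I.graph.Adj c l) :
    (I.starSubgraph c L hL).coe.IsTree := by
  have hc : c ∉ L := fun h => (hL c h).ne rfl
  convert SimpleGraph.isTree_starGraph
    (⟨c, Or.inl rfl⟩ : (I.starSubgraph c L hL).verts) using 1
  ext ⟨v, hv⟩ ⟨w, hw⟩
  simp only [starSubgraph, Set.mem_insert_iff, Finset.mem_coe] at hv hw
  simp only [SimpleGraph.Subgraph.coe_adj, SimpleGraph.starGraph_adj, starSubgraph, ne_eq]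
  grind

/-- A star all of whose leaves are terminals is a full component, provided that its centre is a
terminal exactly when it is itself a leaf. -/
theorem isFullComponent_starSubgraph {c : V} {L K : Finset V} (hL : ∀ l ∈ L, I.graph.Adj c l)
    (hLR : ∀ l ∈ L, l ∈ I.terminals) (hc : c ∈ I.terminals ↔ L.card ≤ 1)
    (hK : ∀ v, v ∈ K ↔ (v = c ∨ v ∈ L) ∧ v ∈ I.terminals) :
    I.IsFullComponent K (I.starSubgraph c L hL) := by
  have hcL : c ∉ L := fun h => (hL c h).ne rfl
  refine ⟨I.isTree_starSubgraph c L hL, hK, ?_⟩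
  rintro v (rfl | hv)
  · have : (I.starSubgraph v L hL).neighborSet v = L := by
      ext w
      simp only [SimpleGraph.Subgraph.mem_neighborSet, starSubgraph, Finset.mem_coe]
      grind
    rw [this, Set.ncard_coe_finset, hc]
  · have : (I.starSubgraph c L hL).neighborSet v = {c} := by
      ext w
      simp only [SimpleGraph.Subgraph.mem_neighborSet, starSubgraph, Set.mem_singleton_iff]
      have hv' : v ∈ L := hv
      grind
    simp [this, hLR v hv]

variable [Fintype V]

section
open Classical

theorem hyperedgeCost_le_sum_darts {K : Finset V} {T : I.graph.Subgraph}
    (hT : I.IsFullComponent K T) (D : Finset I.graph.Dart)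
    (hD : ∀ e ∈ T.edgeSet, ∃ a ∈ D, a.edge = e) :
    I.hyperedgeCost K ≤ ∑ a ∈ D, (I.cost a.edge : ℝ≥0∞) := by
  refine (iInf₂_le T hT).trans ?_
  rw [← ENNReal.ofNNReal_finsetSum, ENNReal.coe_le_coe, subgraphCost]
  calc _ ≤ ∑ e ∈ D.image (·.edge), I.cost e := by
        refine Finset.sum_le_sum_of_subset fun e he => ?_
        simpa using hD e (by simpa using he)
    _ ≤ _ := Finset.sum_image_le_of_nonneg (fun _ _ => zero_le)

theorem exists_isFullComponent_subgraphCost_le {K : Finset V} (hK : I.hyperedgeCost K ≠ ⊤) :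
    ∃ T, I.IsFullComponent K T ∧ (I.subgraphCost T : ℝ≥0∞) ≤ I.hyperedgeCost K := by
  have hne : {T | I.IsFullComponent K T}.Nonempty := by
    by_contra h
    rw [Set.not_nonempty_iff_eq_empty, Set.eq_empty_iff_forall_notMem] at h
    refine hK (top_unique (le_iInf₂ fun T hT => absurd hT (h T)))
  obtain ⟨T, hT, hmin⟩ := Set.exists_min_image _ I.subgraphCost (Set.toFinite _) hne
  exact ⟨T, hT, le_iInf₂ fun T' hT' => ENNReal.coe_le_coe.2 (hmin T' hT')⟩

/-! ### From directed hyperedges to arcs -/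

/-- The arcs of a subgraph `T` that lead closer to its vertex `i`; for a tree, these are all edges
of `T`, oriented towards `i`. -/
noncomputable def arcsTowards (T : I.graph.Subgraph) (i : V) : Finset I.graph.Dart :=
  Finset.univ.filter fun a => ∃ (ha : T.Adj a.fst a.snd) (hi : i ∈ T.verts),
    T.coe.dist ⟨a.snd, T.edge_vert ha.symm⟩ ⟨i, hi⟩ < T.coe.dist ⟨a.fst, T.edge_vert ha⟩ ⟨i, hi⟩

theorem sum_arcsTowards_le (T : I.graph.Subgraph) (i : V) :
    ∑ a ∈ I.arcsTowards T i, I.cost a.edge ≤ I.subgraphCost T := by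
  have hinj : Set.InjOn (fun a : I.graph.Dart => a.edge) (I.arcsTowards T i) := by
    intro a ha b hb hab
    obtain rfl | rfl := SimpleGraph.dart_edge_eq_iff a b |>.1 hab
    · rfl
    · simp only [arcsTowards, Finset.coe_filter, Finset.mem_univ, true_and,
        Set.mem_ofPred_eq] at ha hb
      obtain ⟨_, _, h1⟩ := ha
      obtain ⟨_, _, h2⟩ := hb
      exact absurd h1 h2.le.not_gt
  rw [← Finset.sum_image (f := fun e => I.cost e) hinj, subgraphCost]
  refine Finset.sum_le_sum_of_subset fun e he => ?_
  obtain ⟨a, ha, rfl⟩ := Finset.mem_image.1 he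
  obtain ⟨h, -⟩ := (Finset.mem_filter.1 ha).2
  exact Finset.mem_filter.2 ⟨Finset.mem_univ _, h⟩

/-- If a connected subgraph meets `U` and contains `i ∉ U`, then an arc towards `i` leaves `U`:
take the arc out of a vertex of `U` that is nearest to `i`. -/
theorem exists_mem_arcsTowards_arcsOut {T : I.graph.Subgraph} (hT : T.coe.Connected) {i t : V}
    (hi : i ∈ T.verts) (ht : t ∈ T.verts) {U : Finset V} (htU : t ∈ U) (hiU : i ∉ U) :
    ∃ a ∈ I.arcsTowards T i, a ∈ I.arcsOut U := by
  obtain ⟨⟨v, hv⟩, hvU, hmin⟩ := Set.exists_min_image {v : T.verts | (v : V) ∈ U}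
    (fun v => T.coe.dist v ⟨i, hi⟩) (Set.toFinite _) ⟨⟨t, ht⟩, htU⟩
  obtain ⟨p, hp⟩ := hT.exists_walk_length_eq_dist ⟨v, hv⟩ ⟨i, hi⟩
  cases p with
  | nil => exact absurd hvU hiU
  | @cons _ w _ h q =>
    have hlt : T.coe.dist w ⟨i, hi⟩ < T.coe.dist ⟨v, hv⟩ ⟨i, hi⟩ := by
      rw [← hp]
      exact Nat.lt_succ_of_le (SimpleGraph.dist_le q)
    have hadj : T.Adj v w := h
    refine ⟨⟨(v, w), T.adj_sub hadj⟩, ?_, ?_⟩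
    · exact Finset.mem_filter.2 ⟨Finset.mem_univ _, hadj, hi, hlt⟩
    · refine Finset.mem_filter.2 ⟨Finset.mem_univ _, hvU, fun hw => ?_⟩
      exact (hmin w hw).not_gt hlt

theorem optB_le_optD (r : V) : I.optB r ≤ I.optD r := by
  refine le_iInf₂ fun y hy => ?_
  by_cases hfin : I.valueD y = ⊤
  · rw [hfin]; exact le_top
  have hcost : ∀ h : I.DirHyperedge, y h ≠ 0 → I.hyperedgeCost h.1.1 ≠ ⊤ := by
    intro h hh htop
    refine hfin (ENNReal.sum_eq_top.2 ⟨h, Finset.mem_univ _, ?_⟩)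
    rw [htop, ENNReal.top_mul (by simpa using hh)]
  have hT : ∀ h : I.DirHyperedge, ∃ T : I.graph.Subgraph, y h ≠ 0 →
      I.IsFullComponent h.1.1 T ∧ (I.subgraphCost T : ℝ≥0∞) ≤ I.hyperedgeCost h.1.1 := by
    intro h
    by_cases hh : y h = 0
    · exact ⟨⊥, fun h' => absurd hh h'⟩
    · obtain ⟨T, hT⟩ := I.exists_isFullComponent_subgraphCost_le (hcost h hh)
      exact ⟨T, fun _ => hT⟩
  choose T hT using hT
  let x : I.graph.Dart → ℝ≥0 := fun a => ∑ h, if a ∈ I.arcsTowards (T h) h.1.2 then y h else 0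
  have hx : I.FeasibleB r x := by
    rintro U ⟨⟨t, htR, htU⟩, hrU⟩
    refine (hy (U.filter (· ∈ I.terminals)) (fun v hv => (Finset.mem_filter.1 hv).2)
      ⟨⟨t, htR, Finset.mem_filter.2 ⟨htU, htR⟩⟩, fun h => hrU (Finset.mem_filter.1 h).1⟩).trans ?_
    rw [Finset.sum_comm]
    refine (Finset.sum_le_sum fun h hh => ?_).trans
      (Finset.sum_le_sum_of_subset (Finset.subset_univ _))
    obtain ⟨⟨t', ht', htK⟩, hi⟩ := (Finset.mem_filter.1 hh).2
    by_cases h0 : y h = 0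
    · simp [h0]
    obtain ⟨⟨htree, hverts, -⟩, -⟩ := hT h h0
    have hiK := (hverts h.1.2).1 h.2.2
    obtain ⟨a, ha, haU⟩ := I.exists_mem_arcsTowards_arcsOut htree.connected (U := U) hiK.1
      ((hverts t').1 htK).1 (Finset.mem_filter.1 ht').1
      fun h' => hi (Finset.mem_filter.2 ⟨h', hiK.2⟩)
    refine le_trans ?_ (Finset.single_le_sum (fun _ _ => zero_le) haU)
    rw [if_pos ha]
  refine (iInf₂_le x hx).trans ?_
  unfold valueB valueD
  simp only [x, ENNReal.ofNNReal_finsetSum, Finset.mul_sum]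
  rw [Finset.sum_comm]
  refine Finset.sum_le_sum fun h _ => ?_
  by_cases h0 : y h = 0
  · simp [h0]
  calc _ = ((∑ a ∈ I.arcsTowards (T h) h.1.2, I.cost a.edge : ℝ≥0) : ℝ≥0∞) * y h := by
        rw [ENNReal.ofNNReal_finsetSum, Finset.sum_mul, ← Finset.sum_filter_add_sum_filter_not
          Finset.univ (· ∈ I.arcsTowards (T h) h.1.2)]
        rw [Finset.sum_eq_zero (s := Finset.univ.filter (· ∉ _))]
        · rw [add_zero]
          refine Finset.sum_congr (by ext; simp) fun a ha => ?_
          rw [if_pos ha]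
        · intro a ha
          rw [if_neg (Finset.mem_filter.1 ha).2]; simp
    _ ≤ _ := by
        gcongr
        exact (ENNReal.coe_le_coe.2 (I.sum_arcsTowards_le _ _)).trans (hT h h0).2

/-! ### Mixed solutions -/

/-- A vector with a real entry for every arc and every directed hyperedge. -/
abbrev MixedVector {V : Type*} (I : SteinerInstance V) : Type _ :=
  (I.graph.Dart → ℝ) × (I.DirHyperedge → ℝ)

/-- The total weight of the arcs and directed hyperedges leaving `U`. -/
noncomputable def mixedCut (z : I.MixedVector) (U : Finset V) : ℝ :=
  ∑ a ∈ I.arcsOut U, z.1 a + ∑ h ∈ I.hyperedgesOut U, z.2 h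

/-- The sum of all entries. -/
noncomputable def mass (z : I.MixedVector) : ℝ :=
  ∑ a, z.1 a + ∑ h, z.2 h

/-- The cost of a mixed vector.  Hyperedges of infinite cost are counted as `0` here; they are
excluded from the support in `IsDominated`. -/
noncomputable def mixedCost (z : I.MixedVector) : ℝ :=
  ∑ a, (I.cost a.edge : ℝ) * z.1 a + ∑ h, (I.hyperedgeCost h.1.1).toReal * z.2 h

/-- `z` is a non-negative mixed vector that covers every valid set and whose cost and mass do not
exceed those of `z₀`.  The bound on the mass is what makes the set of these vectors compact, as
hyperedges may be free. -/
structure IsDominated (r : V) (z₀ z : I.MixedVector) : Prop where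
  arc_nonneg : ∀ a, 0 ≤ z.1 a
  hyperedge_nonneg : ∀ h, 0 ≤ z.2 h
  eq_zero_of_cost_eq_top : ∀ h, I.hyperedgeCost h.1.1 = ⊤ → z.2 h = 0
  mass_le : I.mass z ≤ I.mass z₀
  cost_le : I.mixedCost z ≤ I.mixedCost z₀
  one_le_cut : ∀ U, I.IsValid r U → 1 ≤ I.mixedCut z U

theorem isCompact_setOf_isDominated (r : V) (z₀ : I.MixedVector) :
    IsCompact {z | I.IsDominated r z₀ z} := by
  have hset : {z | I.IsDominated r z₀ z} =
      {z | ∀ a, 0 ≤ z.1 a} ∩ {z | ∀ h, 0 ≤ z.2 h} ∩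
      {z | ∀ h, I.hyperedgeCost h.1.1 = ⊤ → z.2 h = 0} ∩ {z | I.mass z ≤ I.mass z₀} ∩
      {z | I.mixedCost z ≤ I.mixedCost z₀} ∩ {z | ∀ U, I.IsValid r U → 1 ≤ I.mixedCut z U} := by
    ext z
    exact ⟨fun ⟨h1, h2, h3, h4, h5, h6⟩ => ⟨⟨⟨⟨⟨h1, h2⟩, h3⟩, h4⟩, h5⟩, h6⟩,
      fun ⟨⟨⟨⟨⟨h1, h2⟩, h3⟩, h4⟩, h5⟩, h6⟩ => ⟨h1, h2, h3, h4, h5, h6⟩⟩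
  refine (isCompact_Icc (a := (0 : I.MixedVector))
    (b := (fun _ => I.mass z₀, fun _ => I.mass z₀))).of_isClosed_subset ?_ ?_
  · rw [hset]
    refine ((((IsClosed.inter ?_ ?_).inter ?_).inter ?_).inter ?_).inter ?_
    · simp only [Set.ofPred_forall]
      exact isClosed_iInter fun a => isClosed_le (by fun_prop) (by fun_prop)
    · simp only [Set.ofPred_forall]
      exact isClosed_iInter fun a => isClosed_le (by fun_prop) (by fun_prop)
    · simp only [Set.ofPred_forall]
      exact isClosed_iInter fun a => isClosed_iInter fun _ =>
        isClosed_eq (by fun_prop) (by fun_prop)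
    · exact isClosed_le (by unfold mass; fun_prop) (by fun_prop)
    · exact isClosed_le (by unfold mixedCost; fun_prop) (by fun_prop)
    · simp only [Set.ofPred_forall]
      exact isClosed_iInter fun a => isClosed_iInter fun _ =>
        isClosed_le (by fun_prop) (by unfold mixedCut; fun_prop)
  · intro z hz
    have h1 : 0 ≤ ∑ a, z.1 a := Finset.sum_nonneg fun a _ => hz.arc_nonneg a
    have h2 : 0 ≤ ∑ h, z.2 h := Finset.sum_nonneg fun h _ => hz.hyperedge_nonneg h
    have hm := hz.mass_le
    unfold mass at hm
    refine ⟨⟨hz.arc_nonneg, hz.hyperedge_nonneg⟩, fun a => ?_, fun h => ?_⟩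
    · have := Finset.single_le_sum (fun a _ => hz.arc_nonneg a) (Finset.mem_univ a)
      simp only [mass]
      linarith
    · have := Finset.single_le_sum (fun h _ => hz.hyperedge_nonneg h) (Finset.mem_univ h)
      simp only [mass]
      linarith

/-! ### Shifting weight from arcs to a hyperedge -/

theorem eventually_le_add_mul {c v d : ℝ} (h : c ≤ v) (h' : v = c → 0 ≤ d) :
    ∀ᶠ ε in 𝓝[>] (0 : ℝ), c ≤ v + ε * d := by
  rcases h.eq_or_lt with rfl | hlt
  · filter_upwards [self_mem_nhdsWithin] with ε hε
    nlinarith [mul_nonneg (le_of_lt (Set.mem_Ioi.1 hε)) (h' rfl)]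
  · have : Tendsto (fun ε : ℝ => v + ε * d) (𝓝[>] 0) (𝓝 (v + 0 * d)) :=
      (Continuous.tendsto (by fun_prop) 0).mono_left nhdsWithin_le_nhds
    filter_upwards [this.eventually (lt_mem_nhds (by simpa using hlt))] with ε hε using hε.le

/-- Move an amount `ε` from each of the arcs in `D` to the hyperedge `h`. -/
noncomputable def shift (z : I.MixedVector) (D : Finset I.graph.Dart) (h : I.DirHyperedge)
    (ε : ℝ) : I.MixedVector :=
  (fun a => z.1 a + ε * if a ∈ D then -1 else 0, fun h' => z.2 h' + ε * if h' = h then 1 else 0)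

theorem mixedCut_shift (z : I.MixedVector) (D : Finset I.graph.Dart) (h : I.DirHyperedge)
    (ε : ℝ) (U : Finset V) :
    I.mixedCut (I.shift z D h ε) U = I.mixedCut z U +
      ε * ((if h ∈ I.hyperedgesOut U then 1 else 0) - ((I.arcsOut U ∩ D).card : ℝ)) := by
  simp only [mixedCut, shift, Finset.sum_add_distrib, ← Finset.mul_sum, Finset.sum_ite_mem,
    Finset.sum_ite_eq', Finset.sum_const, nsmul_eq_mul]
  ring

theorem sum_fst_shift (z : I.MixedVector) (D : Finset I.graph.Dart) (h : I.DirHyperedge)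
    (ε : ℝ) : ∑ a, (I.shift z D h ε).1 a = ∑ a, z.1 a - ε * D.card := by
  simp only [shift, Finset.sum_add_distrib, ← Finset.mul_sum, Finset.sum_ite_mem,
    Finset.sum_const, nsmul_eq_mul, Finset.univ_inter]
  ring

theorem sum_snd_shift (z : I.MixedVector) (D : Finset I.graph.Dart) (h : I.DirHyperedge)
    (ε : ℝ) : ∑ h', (I.shift z D h ε).2 h' = ∑ h', z.2 h' + ε := by
  simp [shift, Finset.sum_add_distrib]

theorem mixedCost_shift (z : I.MixedVector) (D : Finset I.graph.Dart) (h : I.DirHyperedge)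
    (ε : ℝ) : I.mixedCost (I.shift z D h ε) = I.mixedCost z +
      ε * ((I.hyperedgeCost h.1.1).toReal - ∑ a ∈ D, (I.cost a.edge : ℝ)) := by
  have h1 : ∑ a, (I.cost a.edge : ℝ) * (ε * if a ∈ D then -1 else 0) =
      -(ε * ∑ a ∈ D, (I.cost a.edge : ℝ)) := by
    rw [Finset.mul_sum, ← Finset.sum_neg_distrib, ← Finset.sum_filter_add_sum_filter_not
      Finset.univ (· ∈ D), Finset.sum_eq_zero (s := Finset.univ.filter (· ∉ D))]
    · rw [add_zero]
      refine Finset.sum_congr (by ext; simp) fun a ha => ?_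
      rw [if_pos ha]; ring
    · intro a ha
      rw [if_neg (Finset.mem_filter.1 ha).2]; simp
  have h2 : ∑ h', (I.hyperedgeCost h'.1.1).toReal * (ε * if h' = h then 1 else 0) =
      ε * (I.hyperedgeCost h.1.1).toReal := by
    simp [mul_comm]
  simp only [mixedCost, shift, mul_add, Finset.sum_add_distrib]
  rw [h1, h2]
  ring

/-- A small shift is possible if no cut that is tight loses weight. -/
theorem IsDominated.exists_sum_lt {I : SteinerInstance V} {r : V} {z₀ z : I.MixedVector}
    (hz : I.IsDominated r z₀ z) {D : Finset I.graph.Dart} (hD : D.Nonempty)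
    (hpos : ∀ a ∈ D, 0 < z.1 a) (h : I.DirHyperedge)
    (hcost : I.hyperedgeCost h.1.1 ≤ ∑ a ∈ D, (I.cost a.edge : ℝ≥0∞))
    (htight : ∀ U, I.IsValid r U → I.mixedCut z U = 1 → (I.arcsOut U ∩ D).Nonempty →
      (I.arcsOut U ∩ D).card ≤ 1 ∧ h ∈ I.hyperedgesOut U) :
    ∃ z', I.IsDominated r z₀ z' ∧ ∑ a, z'.1 a < ∑ a, z.1 a := by
  have hev1 : ∀ᶠ ε in 𝓝[>] (0 : ℝ), ∀ a, 0 ≤ (I.shift z D h ε).1 a := by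
    refine eventually_all.2 fun a => eventually_le_add_mul (hz.arc_nonneg a) fun h0 => ?_
    have : a ∉ D := fun ha => (hpos a ha).ne' h0
    simp [this]
  have hev2 : ∀ᶠ ε in 𝓝[>] (0 : ℝ), ∀ U, I.IsValid r U → 1 ≤ I.mixedCut (I.shift z D h ε) U := by
    refine eventually_all.2 fun U => eventually_imp_distrib_left.2 fun hU => ?_
    simp only [mixedCut_shift]
    refine eventually_le_add_mul (hz.one_le_cut U hU) fun h0 => ?_
    rcases (I.arcsOut U ∩ D).eq_empty_or_nonempty with he | hne
    · rw [he]; split_ifs <;> simp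
    · obtain ⟨h1, h2⟩ := htight U hU h0 hne
      rw [if_pos h2, sub_nonneg]
      exact_mod_cast h1
  obtain ⟨ε, ⟨h1, h2⟩, hε⟩ := ((hev1.and hev2).and self_mem_nhdsWithin).exists
  replace hε : 0 < ε := hε
  have hcard : (1 : ℝ) ≤ D.card := by exact_mod_cast hD.card_pos
  have hfin : ∑ a ∈ D, (I.cost a.edge : ℝ≥0∞) ≠ ⊤ := by
    rw [← ENNReal.ofNNReal_finsetSum]; exact ENNReal.coe_ne_top
  refine ⟨I.shift z D h ε, ⟨h1, fun h' => ?_, fun h' htop => ?_, ?_, ?_, h2⟩, ?_⟩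
  · have := hz.hyperedge_nonneg h'
    simp only [shift]
    split_ifs <;> simp <;> linarith
  · have : h' ≠ h := by
      rintro rfl
      exact hfin (top_unique (htop ▸ hcost))
    simp [shift, this, hz.eq_zero_of_cost_eq_top h' htop]
  · refine le_trans ?_ hz.mass_le
    rw [mass, mass, sum_fst_shift, sum_snd_shift]
    nlinarith
  · refine le_trans ?_ hz.cost_le
    rw [mixedCost_shift]
    have : (I.hyperedgeCost h.1.1).toReal ≤ ∑ a ∈ D, (I.cost a.edge : ℝ) := by
      have := ENNReal.toReal_mono hfin hcost
      rwa [ENNReal.toReal_sum (fun _ _ => ENNReal.coe_ne_top)] at this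
    nlinarith
  · rw [sum_fst_shift]
    nlinarith

/-! ### Uncrossing -/

theorem mem_hyperedgesOut {h : I.DirHyperedge} {U : Finset V} :
    h ∈ I.hyperedgesOut U ↔ (∃ t ∈ U, t ∈ h.1.1) ∧ h.1.2 ∉ U := by
  simp [hyperedgesOut]

theorem mem_arcsOut {a : I.graph.Dart} {U : Finset V} :
    a ∈ I.arcsOut U ↔ a.fst ∈ U ∧ a.snd ∉ U := by
  simp [arcsOut]

/-- Submodularity of the cut function, with the gain from one arc between `T \ U` and `U \ T`,
in either direction. -/
theorem mixedCut_inter_add_mixedCut_union_add_le {z : I.MixedVector} (h1 : ∀ a, 0 ≤ z.1 a)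
    (h2 : ∀ h, 0 ≤ z.2 h) {T U : Finset V} {a : I.graph.Dart}
    (ha : (a.fst ∈ T \ U ∧ a.snd ∈ U \ T) ∨ (a.fst ∈ U \ T ∧ a.snd ∈ T \ U)) :
    I.mixedCut z (T ∩ U) + I.mixedCut z (T ∪ U) + z.1 a ≤ I.mixedCut z T + I.mixedCut z U := by
  have hsum : ∀ W, ∑ b ∈ I.arcsOut W, z.1 b = ∑ b, if b.fst ∈ W ∧ b.snd ∉ W then z.1 b else 0 :=
    fun W => Finset.sum_filter _ _
  have hsum' : ∀ W, ∑ h ∈ I.hyperedgesOut W, z.2 h =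
      ∑ h : I.DirHyperedge, if (∃ t ∈ W, t ∈ h.1.1) ∧ h.1.2 ∉ W then z.2 h else 0 :=
    fun W => Finset.sum_filter _ _
  have harcs : ∑ b ∈ I.arcsOut (T ∩ U), z.1 b + ∑ b ∈ I.arcsOut (T ∪ U), z.1 b + z.1 a ≤
      ∑ b ∈ I.arcsOut T, z.1 b + ∑ b ∈ I.arcsOut U, z.1 b := by
    have hsingle : z.1 a = ∑ b, if b = a then z.1 b else 0 := by simp
    rw [hsum, hsum, hsum, hsum, hsingle, ← Finset.sum_add_distrib, ← Finset.sum_add_distrib,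
      ← Finset.sum_add_distrib]
    refine Finset.sum_le_sum fun b _ => ?_
    have := h1 b
    simp only [Finset.mem_inter, Finset.mem_union, Finset.mem_sdiff] at ha ⊢
    by_cases hba : b = a
    · subst hba
      rcases ha with ⟨⟨h1, h2⟩, h3, h4⟩ | ⟨⟨h1, h2⟩, h3, h4⟩ <;> simp [h1, h2, h3, h4]
    · by_cases hT : b.fst ∈ T <;> by_cases hU : b.fst ∈ U <;> by_cases hT' : b.snd ∈ T <;>
        by_cases hU' : b.snd ∈ U <;> simp [hT, hU, hT', hU', hba] <;> linarith
  have hhyp : ∑ h ∈ I.hyperedgesOut (T ∩ U), z.2 h + ∑ h ∈ I.hyperedgesOut (T ∪ U), z.2 h ≤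
      ∑ h ∈ I.hyperedgesOut T, z.2 h + ∑ h ∈ I.hyperedgesOut U, z.2 h := by
    rw [hsum', hsum', hsum', hsum', ← Finset.sum_add_distrib, ← Finset.sum_add_distrib]
    refine Finset.sum_le_sum fun h _ => ?_
    have := h2 h
    have hi : (∃ t ∈ T ∩ U, t ∈ h.1.1) → (∃ t ∈ T, t ∈ h.1.1) ∧ ∃ t ∈ U, t ∈ h.1.1 := by
      grind
    have hT0 : h.1.2 ∈ T → ∃ t ∈ T, t ∈ h.1.1 := fun h' => ⟨_, h', h.2.2⟩
    have hU0 : h.1.2 ∈ U → ∃ t ∈ U, t ∈ h.1.1 := fun h' => ⟨_, h', h.2.2⟩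
    simp only [Finset.mem_inter, Finset.mem_union] at hi ⊢
    by_cases hT : h.1.2 ∈ T <;> by_cases hU : h.1.2 ∈ U <;>
      by_cases hp1 : ∃ t ∈ T, t ∈ h.1.1 <;> by_cases hp2 : ∃ t ∈ U, t ∈ h.1.1 <;>
      simp only [hT, hU, hp1, hp2] at hi hT0 hU0 ⊢ <;> split_ifs <;> first | linarith | grind
  unfold mixedCut
  linarith

/-- A tight set `T` avoiding `s` and a tight set `U` containing `s` that share a terminal: no arc
of positive weight joins `s` to `T \ U`. -/
theorem IsDominated.not_pos_of_tight {I : SteinerInstance V} {r : V} {z₀ z : I.MixedVector}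
    (hz : I.IsDominated r z₀ z) {T U : Finset V} (hT : I.IsValid r T) (hU : I.IsValid r U)
    (hT1 : I.mixedCut z T = 1) (hU1 : I.mixedCut z U = 1) {t : V} (ht : t ∈ I.terminals)
    (htT : t ∈ T) (htU : t ∈ U) {a : I.graph.Dart}
    (ha : (a.fst ∈ T \ U ∧ a.snd ∈ U \ T) ∨ (a.fst ∈ U \ T ∧ a.snd ∈ T \ U)) :
    ¬ 0 < z.1 a := by
  have h1 := hz.one_le_cut (T ∩ U) ⟨⟨t, ht, Finset.mem_inter.2 ⟨htT, htU⟩⟩,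
    fun h => hT.2 (Finset.mem_inter.1 h).1⟩
  have h2 := hz.one_le_cut (T ∪ U) ⟨⟨t, ht, Finset.mem_union.2 (Or.inl htT)⟩,
    fun h => (Finset.mem_union.1 h).elim hT.2 hU.2⟩
  have := I.mixedCut_inter_add_mixedCut_union_add_le hz.arc_nonneg hz.hyperedge_nonneg ha
  linarith

/-! ### Eliminating the arcs with terminal heads -/

/-- An arc between two terminals can be replaced by a hyperedge with two elements. -/
theorem IsDominated.exists_sum_lt_of_terminals {I : SteinerInstance V} {r : V}
    {z₀ z : I.MixedVector} (hz : I.IsDominated r z₀ z) {a : I.graph.Dart} (ha : 0 < z.1 a)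
    (hfst : a.fst ∈ I.terminals) (hsnd : a.snd ∈ I.terminals) :
    ∃ z', I.IsDominated r z₀ z' ∧ ∑ b, z'.1 b < ∑ b, z.1 b := by
  have hL : ∀ l ∈ ({a.snd} : Finset V), I.graph.Adj a.fst l := by
    simp
  refine hz.exists_sum_lt (D := {a}) (Finset.singleton_nonempty a) (by simpa using ha)
    ⟨({a.fst, a.snd}, a.snd), by simp [Finset.insert_subset_iff, hfst, hsnd]⟩ ?_ ?_
  · refine I.hyperedgeCost_le_sum_darts (I.isFullComponent_starSubgraph (c := a.fst) hL
      (by simpa using hsnd) (by simp [hfst]) ?_) _ ?_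
    · intro v
      simp only [Finset.mem_insert, Finset.mem_singleton]
      grind
    · intro e
      induction e with | _ v w
      rw [SimpleGraph.Subgraph.mem_edgeSet]
      simp only [starSubgraph, Finset.mem_singleton]
      rintro (⟨rfl, rfl⟩ | ⟨rfl, rfl⟩)
      · exact ⟨a, rfl, rfl⟩
      · exact ⟨a, rfl, Sym2.eq_swap⟩
  · intro U _ _ hne
    refine ⟨(Finset.card_le_card Finset.inter_subset_right).trans (by simp), ?_⟩
    obtain ⟨b, hb⟩ := hne
    simp only [Finset.mem_inter, Finset.mem_singleton, mem_arcsOut] at hb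
    obtain ⟨⟨h1, h2⟩, rfl⟩ := hb
    exact I.mem_hyperedgesOut.2 ⟨⟨b.fst, h1, by simp⟩, h2⟩

/-- If an arc of positive weight leaves the Steiner vertex `s` and leaves the tight set `U ∋ s`,
then an arc of positive weight enters `s` from within `U`: otherwise removing `s` from `U` would
give a valid set with too small a cut. -/
theorem IsDominated.exists_pos_arc_into {I : SteinerInstance V} {r : V} {z₀ z : I.MixedVector}
    (hz : I.IsDominated r z₀ z) {a : I.graph.Dart} (ha : 0 < z.1 a) (hs : a.fst ∉ I.terminals)
    {U : Finset V} (hU : I.IsValid r U) (hU1 : I.mixedCut z U = 1) (hsU : a.fst ∈ U)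
    (hiU : a.snd ∉ U) : ∃ b : I.graph.Dart, 0 < z.1 b ∧ b.fst ∈ U ∧ b.snd = a.fst := by
  by_contra! hno
  have hvalid : I.IsValid r (U.erase a.fst) := by
    obtain ⟨⟨t, ht, htU⟩, hrU⟩ := hU
    exact ⟨⟨t, ht, Finset.mem_erase.2 ⟨fun h => hs (h ▸ ht), htU⟩⟩,
      fun h => hrU (Finset.mem_of_mem_erase h)⟩
  have h1 := hz.one_le_cut _ hvalid
  have hhyp : I.hyperedgesOut (U.erase a.fst) ⊆ I.hyperedgesOut U := by
    intro h hh
    rw [mem_hyperedgesOut] at hh ⊢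
    obtain ⟨⟨t, ht, htK⟩, hi⟩ := hh
    refine ⟨⟨t, Finset.mem_of_mem_erase ht, htK⟩, fun h' => hi (Finset.mem_erase.2 ⟨?_, h'⟩)⟩
    exact fun h'' => hs (h'' ▸ h.2.1 h.2.2)
  have harc : ∑ b ∈ I.arcsOut (U.erase a.fst), z.1 b ≤ ∑ b ∈ (I.arcsOut U).erase a, z.1 b := by
    rw [← Finset.sum_filter_add_sum_filter_not _ (fun b => b.snd = a.fst),
      Finset.sum_eq_zero, zero_add]
    · refine Finset.sum_le_sum_of_subset_of_nonneg (fun b hb => ?_) fun b _ _ => hz.arc_nonneg b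
      simp only [Finset.mem_filter, mem_arcsOut, Finset.mem_erase] at hb ⊢
      refine ⟨fun h => hb.1.1.1 (h ▸ rfl), hb.1.1.2, fun h => hb.1.2 ⟨hb.2, h⟩⟩
    · intro b hb
      simp only [Finset.mem_filter, mem_arcsOut, Finset.mem_erase] at hb
      by_contra h0
      exact hno b (lt_of_le_of_ne (hz.arc_nonneg b) (Ne.symm h0)) hb.1.1.2 hb.2
  have herase := Finset.add_sum_erase (I.arcsOut U) z.1 (I.mem_arcsOut.2 ⟨hsU, hiU⟩)
  have := Finset.sum_le_sum_of_subset_of_nonneg hhyp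
    (f := z.2) (fun h _ _ => hz.hyperedge_nonneg h)
  unfold mixedCut at h1 hU1
  linarith

/-- An arc of positive weight from a Steiner vertex `s` to a terminal `i` can be used up together
with arcs into `s` from a suitable set of terminals: an inclusion-minimal set `K` of tails of arcs
into `s` that meets all tight sets that the arc leaves. -/
theorem IsDominated.exists_sum_lt_of_steiner {I : SteinerInstance V} (hI : I.IsQuasibipartite)
    {r : V} {z₀ z : I.MixedVector} (hz : I.IsDominated r z₀ z) {a : I.graph.Dart}
    (ha : 0 < z.1 a) (hs : a.fst ∉ I.terminals) (hi : a.snd ∈ I.terminals) :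
    ∃ z', I.IsDominated r z₀ z' ∧ ∑ b, z'.1 b < ∑ b, z.1 b := by
  let Tight : Finset V → Prop := fun U => I.IsValid r U ∧ I.mixedCut z U = 1
  let P : Finset V → Prop := fun K =>
    (∀ k ∈ K, ∃ b : I.graph.Dart, 0 < z.1 b ∧ b.fst = k ∧ b.snd = a.fst) ∧
    ∀ U, Tight U → a.fst ∈ U → a.snd ∉ U → ∃ k ∈ K, k ∈ U
  obtain ⟨K, -, ⟨hKarc, hKhit⟩, hKmin⟩ := exists_minimal_le_of_wellFoundedLT P
    (Finset.univ.filter fun k => ∃ b : I.graph.Dart, 0 < z.1 b ∧ b.fst = k ∧ b.snd = a.fst) <| by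
      refine ⟨fun k hk => (Finset.mem_filter.1 hk).2, fun U hU hsU hiU => ?_⟩
      obtain ⟨b, hb, hbU, hbs⟩ := hz.exists_pos_arc_into ha hs hU.1 hU.2 hsU hiU
      exact ⟨b.fst, Finset.mem_filter.2 ⟨Finset.mem_univ _, b, hb, rfl, hbs⟩, hbU⟩
  have hcrit : ∀ k ∈ K, ∃ U, Tight U ∧ a.fst ∈ U ∧ a.snd ∉ U ∧ k ∈ U ∧ ∀ l ∈ K, l ∈ U → l = k := by
    intro k hk
    by_contra! hno
    refine Finset.notMem_erase k K (hKmin (y := K.erase k) ⟨fun l hl => hKarc l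
      (Finset.mem_of_mem_erase hl), fun U hU hsU hiU => ?_⟩ (Finset.erase_subset k K) hk)
    by_cases hkU : k ∈ U
    · obtain ⟨l, hl, hlU, hlk⟩ := hno U hU hsU hiU hkU
      exact ⟨l, Finset.mem_erase.2 ⟨hlk, hl⟩, hlU⟩
    · obtain ⟨l, hl, hlU⟩ := hKhit U hU hsU hiU
      exact ⟨l, Finset.mem_erase.2 ⟨fun h => hkU (h ▸ hlU), hl⟩, hlU⟩
  have hKR : ∀ k ∈ K, k ∈ I.terminals := by
    intro k hk
    obtain ⟨b, -, rfl, hb⟩ := hKarc k hk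
    by_contra hbR
    exact hI hbR (show b.snd ∉ I.terminals from hb ▸ hs) b.adj.ne b.adj
  have hKadj : ∀ k ∈ K, I.graph.Adj a.fst k := by
    intro k hk
    obtain ⟨b, -, rfl, hb⟩ := hKarc k hk
    exact hb ▸ b.adj.symm
  have hiK : a.snd ∉ K := by
    intro h
    obtain ⟨U, -, -, h1, h2, -⟩ := hcrit _ h
    exact h1 h2
  -- A tight set that avoids `s` and contains `k ∈ K` contains neither `i` nor another element of `K`.
  have huncross : ∀ T, Tight T → a.fst ∉ T → ∀ k ∈ K, k ∈ T →
      a.snd ∉ T ∧ ∀ l ∈ K, l ∈ T → l = k := by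
    intro T hT hsT k hk hkT
    obtain ⟨U, hU, hsU, hiU, hkU, honly⟩ := hcrit k hk
    refine ⟨fun hiT => ?_, fun l hl hlT => ?_⟩
    · exact hz.not_pos_of_tight hT.1 hU.1 hT.2 hU.2 (hKR k hk) hkT hkU
        (Or.inr ⟨by simp [hsU, hsT], by simp [hiU, hiT]⟩) ha
    · by_contra hlk
      obtain ⟨b, hb, rfl, hbs⟩ := hKarc l hl
      have hlU : b.fst ∉ U := fun h => hlk (honly _ hl h)
      exact hz.not_pos_of_tight hT.1 hU.1 hT.2 hU.2 (hKR k hk) hkT hkU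
        (Or.inl ⟨by simp [hlT, hlU], by simp [hbs, hsU, hsT]⟩) hb
  let D : Finset I.graph.Dart :=
    insert a (Finset.univ.filter fun b => b.snd = a.fst ∧ b.fst ∈ K)
  have hD : ∀ b, b ∈ D ↔ b = a ∨ (b.snd = a.fst ∧ b.fst ∈ K) := by simp [D]
  refine hz.exists_sum_lt (D := D) ⟨a, (hD a).2 (Or.inl rfl)⟩ ?_
    ⟨(insert a.snd K, a.snd), Finset.insert_subset hi hKR, Finset.mem_insert_self _ _⟩ ?_ ?_
  · intro b hb
    obtain rfl | ⟨hb1, hb2⟩ := (hD b).1 hb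
    · exact ha
    · obtain ⟨b', hb', h1, h2⟩ := hKarc _ hb2
      rwa [SimpleGraph.Dart.ext b b' (Prod.ext h1.symm (hb1.trans h2.symm))]
  · rcases K.eq_empty_or_nonempty with rfl | hne
    · -- The hyperedge `{i}` is the star with centre `i` and no leaves.
      refine I.hyperedgeCost_le_sum_darts (I.isFullComponent_starSubgraph (c := a.snd) (L := ∅)
        (by simp) (by simp) (by simp [hi]) ?_) _ ?_
      · intro v
        simp only [Finset.mem_insert, Finset.notMem_empty, or_false]
        grind
      · intro e
        induction e with | _ v w
        simp [starSubgraph]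
    · have hL : ∀ l ∈ insert a.snd K, I.graph.Adj a.fst l := by
        intro l hl
        obtain rfl | hl := Finset.mem_insert.1 hl
        exacts [a.adj, hKadj l hl]
      refine I.hyperedgeCost_le_sum_darts (I.isFullComponent_starSubgraph hL
        (fun l hl => (Finset.insert_subset hi hKR) hl) (iff_of_false hs ?_) ?_) _ ?_
      · rw [Finset.card_insert_of_notMem hiK]
        have := hne.card_pos
        omega
      · intro v
        have : v ∈ insert a.snd K → v ∈ I.terminals := fun h => (Finset.insert_subset hi hKR) h
        grind
      · have hedge : ∀ l ∈ insert a.snd K, ∃ b ∈ D, b.edge = s(a.fst, l) := by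
          intro l hl
          obtain rfl | hl := Finset.mem_insert.1 hl
          · exact ⟨a, (hD a).2 (Or.inl rfl), rfl⟩
          · exact ⟨⟨(l, a.fst), (hKadj l hl).symm⟩, (hD _).2 (Or.inr ⟨rfl, hl⟩), Sym2.eq_swap⟩
        intro e
        induction e with | _ v w
        rw [SimpleGraph.Subgraph.mem_edgeSet]
        rintro (⟨rfl, h⟩ | ⟨rfl, h⟩)
        · exact hedge w h
        · rw [Sym2.eq_swap]; exact hedge v h
  · intro U hU hU1 hne
    have hmem : ∀ b, b ∈ I.arcsOut U ∩ D ↔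
        (b.fst ∈ U ∧ b.snd ∉ U) ∧ (b = a ∨ (b.snd = a.fst ∧ b.fst ∈ K)) := by
      intro b
      rw [Finset.mem_inter, mem_arcsOut, hD]
    obtain ⟨b, hb⟩ := hne
    obtain ⟨⟨hbU, hbU'⟩, hb⟩ := (hmem b).1 hb
    by_cases hsU : a.fst ∈ U
    · -- Only the arc `a` itself can leave a set containing `s`.
      obtain rfl : b = a := hb.resolve_right fun h => hbU' (h.1 ▸ hsU)
      constructor
      · refine Finset.card_le_one.2 fun c hc d hd => ?_
        have h' : ∀ c ∈ I.arcsOut U ∩ D, c = b := fun c hc =>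
          ((hmem c).1 hc).2.resolve_right fun h => ((hmem c).1 hc).1.2 (h.1 ▸ hsU)
        rw [h' c hc, h' d hd]
      · obtain ⟨k, hk, hkU⟩ := hKhit U ⟨hU, hU1⟩ hbU hbU'
        exact I.mem_hyperedgesOut.2 ⟨⟨k, hkU, Finset.mem_insert_of_mem hk⟩, hbU'⟩
    · have h' : ∀ c ∈ I.arcsOut U ∩ D, c.snd = a.fst ∧ c.fst ∈ K ∧ c.fst ∈ U := fun c hc => by
        obtain ⟨⟨h1, h2⟩, rfl | h3⟩ := (hmem c).1 hc
        exacts [absurd h1 hsU, ⟨h3.1, h3.2, h1⟩]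
      obtain ⟨hbs, hbK, -⟩ := h' b ((hmem b).2 ⟨⟨hbU, hbU'⟩, hb⟩)
      obtain ⟨hiU, honly⟩ := huncross U ⟨hU, hU1⟩ hsU _ hbK hbU
      constructor
      · refine Finset.card_le_one.2 fun c hc d hd => SimpleGraph.Dart.ext _ _ (Prod.ext ?_ ?_)
        · exact (honly _ (h' c hc).2.1 (h' c hc).2.2).trans
            (honly _ (h' d hd).2.1 (h' d hd).2.2).symm
        · exact (h' c hc).1.trans (h' d hd).1.symm
      · exact I.mem_hyperedgesOut.2 ⟨⟨_, hbU, Finset.mem_insert_of_mem hbK⟩, hiU⟩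

theorem optD_le_optB (hI : I.IsQuasibipartite) (r : V) (hr : r ∈ I.terminals) :
    I.optD r ≤ I.optB r := by
  refine le_iInf₂ fun x hx => ?_
  let z₀ : I.MixedVector := (fun a => x a, 0)
  have hz₀ : I.IsDominated r z₀ z₀ := by
    refine ⟨fun a => (x a).2, fun _ => le_rfl, fun _ _ => rfl, le_rfl, le_rfl, fun U hU => ?_⟩
    have := hx U hU
    simp only [mixedCut, z₀, Pi.zero_apply, Finset.sum_const_zero, add_zero]
    exact_mod_cast this
  obtain ⟨z, hz, hmin⟩ := (I.isCompact_setOf_isDominated r z₀).exists_isMinOn ⟨z₀, hz₀⟩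
    (f := fun z => ∑ a, z.1 a) (Continuous.continuousOn (by fun_prop))
  have hzero : ∀ a, a.snd ∈ I.terminals → z.1 a = 0 := by
    intro a ha
    by_contra h0
    have hpos : 0 < z.1 a := lt_of_le_of_ne (hz.arc_nonneg a) (Ne.symm h0)
    obtain ⟨z', hz', hlt⟩ : ∃ z', I.IsDominated r z₀ z' ∧ ∑ b, z'.1 b < ∑ b, z.1 b := by
      by_cases hs : a.fst ∈ I.terminals
      · exact hz.exists_sum_lt_of_terminals hpos hs ha
      · exact hz.exists_sum_lt_of_steiner hI hpos hs ha
    exact (hmin hz').not_gt hlt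
  let y : I.DirHyperedge → ℝ≥0 := fun h => ⟨z.2 h, hz.hyperedge_nonneg h⟩
  have hy : I.FeasibleD r y := by
    intro U hUR hU
    -- All arcs leaving the union of `U` with the set of Steiner vertices have terminal heads.
    have hW := hz.one_le_cut (U ∪ Finset.univ.filter (· ∉ I.terminals)) ⟨by
      obtain ⟨t, ht, htU⟩ := hU.1
      exact ⟨t, ht, Finset.mem_union_left _ htU⟩, by simp [hU.2, hr]⟩
    rw [mixedCut, Finset.sum_eq_zero, zero_add] at hW
    · have hsub : I.hyperedgesOut (U ∪ Finset.univ.filter (· ∉ I.terminals)) ⊆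
          I.hyperedgesOut U := by
        intro h hh
        rw [mem_hyperedgesOut] at hh ⊢
        obtain ⟨⟨t, ht, htK⟩, hi⟩ := hh
        refine ⟨⟨t, ?_, htK⟩, fun h' => hi (Finset.mem_union_left _ h')⟩
        have := h.2.1 htK
        simpa [this] using ht
      have := hW.trans (Finset.sum_le_sum_of_subset_of_nonneg hsub
        fun h _ _ => hz.hyperedge_nonneg h)
      rw [← NNReal.coe_le_coe, NNReal.coe_sum, NNReal.coe_one]
      exact this
    · intro a ha
      rw [mem_arcsOut] at ha
      refine hzero a ?_
      by_contra h
      exact ha.2 (Finset.mem_union_right _ (by simpa using h))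
  refine (iInf₂_le y hy).trans ?_
  have hD : I.valueD y =
      ENNReal.ofReal (∑ h, (I.hyperedgeCost h.1.1).toReal * z.2 h) := by
    rw [valueD, ENNReal.ofReal_sum_of_nonneg fun h _ =>
      mul_nonneg ENNReal.toReal_nonneg (hz.hyperedge_nonneg h)]
    refine Finset.sum_congr rfl fun h _ => ?_
    rw [ENNReal.ofReal_mul ENNReal.toReal_nonneg]
    have hyh : ENNReal.ofReal (z.2 h) = y h := ENNReal.ofReal_eq_coe_nnreal (hz.hyperedge_nonneg h)
    rw [hyh]
    by_cases htop : I.hyperedgeCost h.1.1 = ⊤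
    · have : y h = 0 := Subtype.ext (hz.eq_zero_of_cost_eq_top h htop)
      simp [this]
    · rw [ENNReal.ofReal_toReal htop]
  have hB : I.valueB x = ENNReal.ofReal (I.mixedCost z₀) := by
    simp only [mixedCost, z₀, Pi.zero_apply, mul_zero, Finset.sum_const_zero, add_zero]
    rw [valueB, ENNReal.ofReal_sum_of_nonneg fun a _ => by positivity]
    refine Finset.sum_congr rfl fun a _ => ?_
    rw [ENNReal.ofReal_mul (by positivity), ENNReal.ofReal_coe_nnreal, ENNReal.ofReal_coe_nnreal]
  rw [hD, hB]
  refine ENNReal.ofReal_le_ofReal (le_trans ?_ hz.cost_le)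
  rw [mixedCost]
  have : 0 ≤ ∑ a, (I.cost a.edge : ℝ) * z.1 a :=
    Finset.sum_nonneg fun a _ => mul_nonneg (by positivity) (hz.arc_nonneg a)
  linarith

end

end SteinerInstance

theorem mainTheorem4 {V : Type*} [Fintype V] (I : SteinerInstance V)
    (hI : I.IsQuasibipartite) (r : V) (hr : r ∈ I.terminals) :
    I.optB r ≥ I.optD r ∧ I.optB r = I.optD r :=
  ⟨I.optD_le_optB hI r hr, le_antisymm (I.optB_le_optD r) (I.optD_le_optB hI r hr)⟩
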